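/- **Theorem 2.** Fix numbers $M,T,n_a,n_1,\dots,n_M$ and $l_i,l_f\ge 0$; put $l=l_i+l_f$, $n=\max_i n_i$, $L=\lceil\log_2 n\rceil+\lceil\log_2 M\rceil$ (with $\lceil\log_2 0\rceil:=0$). Data are rationals $y$ with $\bar y:=2^{l_f}y\in[-2^{l-1},2^{l-1})\cap\mathbb Z$. For the statistical security parameter $\lambda$ put $$\gamma=2l+1+L,\qquad \delta=\max(l+2+L,\lambda)+3l+4+2L,\qquad \tilde y=\bar y+2^\gamma .$$ The packed scheme $\mathrm{pWSAh}^\ast$ for $\sum_{i=1}^M W_ix_i(t)$, with $W_i$ of size $n_a\times n_i$ and $x_i(t)$ of size $n_i$, is the following. * $\mathrm{Setup}(1^\kappa)$: generate primes $p,q$ of equal bit length with $N=pq$, $\lfloor\log_2N\rfloor=\kappa$, $\gcd(\phi(N),N)=1$. The Paillier public key is $N$, the secret key is $(\phi(N),\phi(N)^{-1}\bmod N)$, and $\mathrm E(y)=(1+N)^y r^N\bmod N^2$ with fresh uniform $r\in(\mathbb Z/N\mathbb Z)^\ast$. For all $t\in[T]$, $k\in[n_a]$, $i\in[M]$ choose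 independent uniform shares $s_i^{[k]}(t)\in\mathbb Z/2^\gamma\mathbb Z$ (identified with $\{0,\dots,2^\gamma-1\}$), and put $s_a^{[k]}(t)=-\sum_i s_i^{[k]}(t)\in\mathbb Z/2^\gamma\mathbb Z$. Agent $i$ gets $\mathrm{sk}_i=(s_i(t))_t$, and the aggregator gets the Paillier secret key and $(s_a(t))_t$. * Packing: with $m=\max(1,\lfloor\lfloor\log_2N\rfloor/\delta\rfloor)$, a vector of $n_a$ nonnegative integers is cut into $\lceil n_a/m\rceil$ blocks of at most $m$ consecutive entries, and a block $(y_1,y_2,\dots)$ becomes the plaintext $\sum_j y_j2^{(j-1)\delta}$. * $\mathrm{InitW}(W_i)$: encrypt the packed columns of $(\tilde W_i^{[kc]})$. * $\mathrm{Enc}$: with fresh uniform $z^{[k]}\in\{0,\dots,2^{l+1+\lambda+\lceil\log_2n_i\rceil}-1\}$, agent $i$ outputs, for each block, $\prod_c \mathrm E(W_i^{c})^{\tilde x_i^{[c]}(t)}\cdot \mathrm E(\text{packed } s_i^{[k]}(t)+2^\gamma z^{[k]})\bmod N^2$. * $\mathrm{AggrDec}$: multiply the agents' ciphertexts, decrypt,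 add the packed $s_a(t)$, split into slots of $\delta$ bits, take the representative of each slot modulo $2^\gamma$ in $[-2^{\gamma-1},2^{\gamma-1})$, and divide by $2^{2l_f}$. Let keys be drawn by any generator as above (a distribution on keys for each $\kappa$ whose keys satisfy $\lfloor\log_2 N\rfloor=\kappa$ whenever such keys exist), and let $\lambda=\lambda(\kappa)$ be such that $2^{-\lambda(\kappa)}$ is negligible. Then: 1. (Correctness) Whenever $\delta\le\lfloor\log_2N\rfloor$, for all weights, data and time steps and all random choices of $\mathrm{Setup}$, $\mathrm{InitW}$, $\mathrm{Enc}$, the output of $\mathrm{AggrDec}$ is exactly $\sum_iW_ix_i(t)$. 2. (Aggregator obliviousness) Every family of probabilistic adversaries, of any running time (in particular every probabilistic polynomial-time one), has advantage $|\Pr[b'=b]-\tfrac12|\le\eta(\kappa)$ with $\eta$ negligible in the following game. The challenger runs $\mathrm{Setup}$, publishes $\kappa$ and $N$, and draws $b\in\{0,1\}$ uniformly. The adversary makes, adaptively: compromise queries for agents or the aggregator, answered by the secret key of that participant; at most one encryption query $(i,t,W_i^0,W_i^1,x_i(t))$ for each $(i,t)$, answered by $\mathrm{Enc}(\mathrm{InitW}(W_i^\beta),\mathrm{sk}_i,t,x_i(t))$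 for $\beta=0$ and $\beta=1$; and exactly one challenge, which consists of a time $t^\ast$, a set of participants $S^\ast$, and $W_i^0,W_i^1,x_i^0(t^\ast),x_i^1(t^\ast)$ for the agents $i\in S^\ast$, answered by $\mathrm{Enc}(\mathrm{InitW}(W_i^b),\mathrm{sk}_i,t^\ast,x_i^b(t^\ast))$ for these agents. It uses the same pair $W_i^0,W_i^1$ for agent $i$ throughout, and finally outputs $b'$. With $U^\ast$ the set of participants that were never compromised and for which no encryption query was made at time $t^\ast$, it must respect $S^\ast\subseteq U^\ast$ and, if $S^\ast=U^\ast$ does not contain the aggregator, $\sum_{i\in S^\ast}W_i^0x_i^0(t^\ast)=\sum_{i\in S^\ast}W_i^1x_i^1(t^\ast)$. If it breaks a rule, $b'$ is replaced by a fair coin. -/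

import Mathlib

open scoped BigOperators

namespace PackedWSA

/-! ## Dimensions, fixed-point data, packing parameters -/

/-- The public dimensions: `M` agents, time steps `0, …, T-1`, aggregate of dimension `na`, local
data of agent `i` of dimension `n i`, and fixed-point numbers with `li` integer bits (including the
sign) and `lf` fractional bits. -/
structure System where
  M : ℕ
  T : ℕ
  na : ℕ
  n : Fin M → ℕ
  li : ℕ
  lf : ℕ

namespace System

variable (D : System)

/-- Message size in bits. -/
def l : ℕ := D.li + D.lf

/-- The largest local dimension. -/
def nMax : ℕ := Finset.univ.sup D.n

/-- The offset exponent `γ = 2l + 1 + ⌈log₂ n⌉ + ⌈log₂ M⌉`. -/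
def gam : ℕ := 2 * D.l + 1 + Nat.clog 2 D.nMax + Nat.clog 2 D.M

/-- The slot width
`δ = max (l + 2 + ⌈log₂ n⌉ + ⌈log₂ M⌉, λ) + 3l + 4 + 2 (⌈log₂ n⌉ + ⌈log₂ M⌉)`. -/
def del (lam : ℕ) : ℕ :=
  max (D.l + 2 + Nat.clog 2 D.nMax + Nat.clog 2 D.M) lam
    + 3 * D.l + 4 + 2 * (Nat.clog 2 D.nMax + Nat.clog 2 D.M)

/-- Bit length `l + 1 + λ + ⌈log₂ nᵢ⌉` of the noise `z` of agent `i`. -/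
def noiseBits (lam : ℕ) (i : Fin D.M) : ℕ := D.l + 1 + lam + Nat.clog 2 (D.n i)

/-- Rationals `y` for which `2 ^ lf * y` is an integer in `[-2 ^ (l-1), 2 ^ (l-1))`. -/
def FixedPt : Type :=
  {y : ℚ // ∃ a : ℤ, -2 ^ D.l ≤ 2 * a ∧ 2 * a < 2 ^ D.l ∧ y * 2 ^ D.lf = a}

/-- Weight matrices for agent `i`. -/
abbrev Weights (i : Fin D.M) : Type := Matrix (Fin D.na) (Fin (D.n i)) D.FixedPt

/-- Local data of agent `i` at one time step. -/
abbrev Data (i : Fin D.M) : Type := Fin (D.n i) → D.FixedPt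

variable {D}

/-- The integer `ȳ = y * 2 ^ lf`. -/
def bar (y : D.FixedPt) : ℤ := ⌊y.1 * 2 ^ D.lf⌋

/-- The nonnegative integer `ỹ = ȳ + 2 ^ γ`. -/
def tilde (y : D.FixedPt) : ℕ := (bar y + 2 ^ D.gam).toNat

/-- The exact product `W x` over the rationals. -/
def apply {i : Fin D.M} (W : D.Weights i) (x : D.Data i) : Fin D.na → ℚ :=
  (W.map fun a => a.1).mulVec fun c => (x c).1

end System

/-! ## The Paillier cryptosystem -/

/-- Paillier key material: two primes of equal bit length with `gcd (φ N, N) = 1`, `N = p q`. -/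
structure PaillierKey where
  p : ℕ
  q : ℕ
  hp : p.Prime
  hq : q.Prime
  equalSize : Nat.log 2 p = Nat.log 2 q
  coprime : Nat.Coprime (Nat.totient (p * q)) (p * q)

namespace PaillierKey

/-- The modulus, which is the public key. -/
def N (K : PaillierKey) : ℕ := K.p * K.q

/-- `⌊log₂ N⌋`. -/
def bits (K : PaillierKey) : ℕ := Nat.log 2 K.N

instance (K : PaillierKey) : NeZero K.N := ⟨Nat.mul_ne_zero K.hp.ne_zero K.hq.ne_zero⟩

end PaillierKey

/-- The secret key `(φ(N), φ(N)⁻¹ mod N)`. -/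
def secretKey (K : PaillierKey) : ℕ × ZMod K.N :=
  (Nat.totient K.N, ((Nat.totient K.N : ℕ) : ZMod K.N)⁻¹)

/-- `E(x) = (1 + N) ^ x * r ^ N mod N ^ 2`, with randomness `r ∈ (ℤ/Nℤ)ˣ`. -/
def encryptP (N : ℕ) (x : ℕ) (r : (ZMod N)ˣ) : ZMod (N ^ 2) :=
  (1 + (N : ZMod (N ^ 2))) ^ x * ((r : ZMod N).val : ZMod (N ^ 2)) ^ N

/-- `D(c) = (c ^ φ(N) - 1) / N * φ(N)⁻¹ mod N`. -/
def decryptP (N : ℕ) (sk : ℕ × ZMod N) (c : ZMod (N ^ 2)) : ZMod N :=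
  ((((c ^ sk.1).val - 1) / N : ℕ) : ZMod N) * sk.2

/-- A key generator: for each security parameter `κ`, a distribution on Paillier keys, which
outputs keys with `⌊log₂ N⌋ = κ` whenever there are such keys. -/
def IsKeyGenerator (gen : ℕ → PMF PaillierKey) : Prop :=
  ∀ κ, (∃ K : PaillierKey, K.bits = κ) → ∀ K ∈ (gen κ).support, K.bits = κ

/-! ## Packing -/

section Packing

variable (D : System) (lam N : ℕ)

/-- The number of slots in one plaintext: the largest `m` with `m δ ≤ ⌊log₂ N⌋` (and `1` if there is
not even room for one slot, a case in which nothing is claimed about decryption). -/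
def capacity : ℕ := max 1 (Nat.log 2 N / D.del lam)

/-- The number `⌈na / m⌉` of plaintexts needed for a vector with `na` entries. -/
def blocks : ℕ := (D.na + capacity D lam N - 1) / capacity D lam N

theorem blockOf_lt (k : Fin D.na) :
    k.1 / capacity D lam N < blocks D lam N := by
  have hm : 0 < capacity D lam N := lt_of_lt_of_le Nat.one_pos (le_max_left _ _)
  have h : k.1 / capacity D lam N + 1 ≤ blocks D lam N := by
    unfold blocks
    rw [← Nat.add_div_right _ hm]
    exact Nat.div_le_div_right (by have := k.2; omega)
  exact h

/-- The plaintext that holds entry `k`. -/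
def blockOf (k : Fin D.na) : Fin (blocks D lam N) :=
  ⟨k.1 / capacity D lam N, blockOf_lt D lam N k⟩

/-- The position of the slot of entry `k` in its plaintext. -/
def slotOf (k : Fin D.na) : ℕ := k.1 % capacity D lam N

/-- Pack a vector of nonnegative integers into plaintexts with slots of width `δ`. -/
def pack (y : Fin D.na → ℕ) (β : Fin (blocks D lam N)) : ℕ :=
  ∑ k : Fin D.na, if blockOf D lam N k = β then y k * 2 ^ (slotOf D lam N k * D.del lam) else 0

/-- Read the slots of packed plaintexts. -/
def unpack (P : Fin (blocks D lam N) → ℕ) (k : Fin D.na) : ℕ :=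
  P (blockOf D lam N k) / 2 ^ (slotOf D lam N k * D.del lam) % 2 ^ D.del lam

/-! ## The scheme

Randomized algorithms are written as functions of explicit coins; the coins are uniform on their
type. -/

/-- Packed ciphertexts of a vector with `na` entries. -/
abbrev Cipher : Type := Fin (blocks D lam N) → ZMod (N ^ 2)

/-- A mask of each slot at each time step: the share of zero of one participant. -/
abbrev Shares : Type := Fin D.T → Fin D.na → ZMod (2 ^ D.gam)

/-- Coins of `Setup` (beyond key generation): the shares of the agents. -/
abbrev SetupCoins : Type := Fin D.M → Shares D

/-- Coins of `InitW` for agent `i`: Paillier randomness for each column and plaintext. -/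
abbrev InitCoins (i : Fin D.M) : Type := Fin (D.n i) → Fin (blocks D lam N) → (ZMod N)ˣ

/-- Coins of `Enc` for agent `i`: the noise `z` of each slot, and Paillier randomness. -/
abbrev EncCoins (i : Fin D.M) : Type :=
  (Fin D.na → Fin (2 ^ D.noiseBits lam i)) × (Fin (blocks D lam N) → (ZMod N)ˣ)

variable {D}

/-- The share of the aggregator: all shares together sum to zero in `ℤ/2^γℤ`. -/
def aggShares (s : SetupCoins D) : Shares D := fun t k => -∑ i, s i t k

/-- `InitW`: encryptions of the packed columns of the weight matrix of agent `i`. -/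
def initW {i : Fin D.M} (W : D.Weights i) (r : InitCoins D lam N i) :
    Fin (D.n i) → Cipher D lam N :=
  fun c β => encryptP N (pack D lam N (fun k => System.tilde (W k c)) β) (r c β)

/-- `Enc`: scalar multiplication of the encrypted columns, summation over the columns, and addition
of the packed masks `s + 2 ^ γ z`. -/
def enc {i : Fin D.M} (sw : Fin (D.n i) → Cipher D lam N) (sk : Shares D) (t : Fin D.T)
    (x : D.Data i) (r : EncCoins D lam N i) : Cipher D lam N :=
  fun β => (∏ c, sw c β ^ System.tilde (x c)) *
    encryptP N (pack D lam N (fun k => (sk t k).val + 2 ^ D.gam * (r.1 k).val) β) (r.2 β)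

/-- `AggrDec`: multiply the ciphertexts, decrypt, add the packed share of the aggregator, unpack,
reduce each slot modulo `2 ^ γ` to a signed residue in `[-2 ^ (γ-1), 2 ^ (γ-1))`, rescale. -/
def aggrDec (sk : ℕ × ZMod N) (sa : Shares D) (t : Fin D.T)
    (c : Fin D.M → Cipher D lam N) : Fin D.na → ℚ :=
  fun k =>
    let P := fun β =>
      (decryptP N sk (∏ i, c i β)).val + pack D lam N (fun k' => (sa t k').val) β
    (Int.bmod (unpack D lam N P k : ℤ) (2 ^ D.gam) : ℚ) / 2 ^ (2 * D.lf)

end Packing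

/-- Correctness: for every key whose plaintexts have room for at least one slot, the aggregator
recovers `∑ i, W i x i` exactly, whatever the coins of `Setup`, `InitW` and `Enc` are. -/
def IsCorrect (D : System) (gen : ℕ → PMF PaillierKey) (lam : ℕ → ℕ) : Prop :=
  ∀ κ, ∀ K ∈ (gen κ).support, D.del (lam κ) ≤ K.bits →
    ∀ (s : SetupCoins D) (W : ∀ i, D.Weights i) (rW : ∀ i, InitCoins D (lam κ) K.N i)
      (t : Fin D.T) (x : ∀ i, D.Data i) (r : ∀ i, EncCoins D (lam κ) K.N i),
      aggrDec (lam κ) K.N (secretKey K) (aggShares s) t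
        (fun i => enc (lam κ) K.N (initW (lam κ) K.N (W i) (rW i)) (s i) t (x i) (r i))
      = ∑ i, System.apply (W i) (x i)

/-! ## The aggregator obliviousness game

A participant is an `Option (Fin M)`: `some i` is agent `i`, and `none` is the aggregator. -/

/-- A challenge: a time step, a set of participants, and two series of weights and of data (only the
entries of agents in `S` are used). -/
structure Challenge (D : System) where
  t : Fin D.T
  S : Finset (Option (Fin D.M))
  W : Bool → ∀ i, D.Weights i
  x : Bool → ∀ i, D.Data i

/-- The queries of the adversary. -/
inductive Query (D : System) where
  | compromise (j : Option (Fin D.M))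
  | encrypt (i : Fin D.M) (t : Fin D.T) (W : Bool → D.Weights i) (x : D.Data i)
  | challenge (ch : Challenge D)

/-- The answers of the challenger, for a public modulus `N`. -/
inductive Answer (D : System) (lam N : ℕ) where
  | agentKey (sk : Shares D)
  | aggKey (sk : ℕ × ZMod N) (sa : Shares D)
  | ciphers (c : Bool → Cipher D lam N)
  | challenge (c : Fin D.M → Option (Cipher D lam N))

/-- The view of the adversary: the queries so far, in chronological order, with their answers. -/
abbrev History (D : System) (lam N : ℕ) : Type := List (Query D × Answer D lam N)

/-- A probabilistic adversary, not bounded in computing power. It sees the public modulus `N` and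
its view, asks adaptively at most `steps` queries (`none` means that it stops asking), and outputs a
guess. -/
structure Adversary (D : System) (lam : ℕ) where
  Coins : Type
  coins : PMF Coins
  steps : ℕ
  next : Coins → (N : ℕ) → History D lam N → Option (Query D)
  guess : Coins → (N : ℕ) → History D lam N → Bool

/-- The coins of the challenger: those of `Setup`, those of `InitW` and `Enc` for the two ciphertexts
of each encryption query (there is at most one for each agent and time step), and those of `InitW`
and `Enc` for each agent in the challenge. -/
abbrev Tape (D : System) (lam N : ℕ) : Type :=
  SetupCoins D ×
  (∀ i : Fin D.M, Fin D.T → Bool → InitCoins D lam N i × EncCoins D lam N i) ×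
  (∀ i : Fin D.M, InitCoins D lam N i × EncCoins D lam N i)

instance (D : System) (lam N : ℕ) [NeZero N] : Fintype (Tape D lam N) :=
  have : ∀ i : Fin D.M, Fintype (InitCoins D lam N i × EncCoins D lam N i) :=
    fun _ => inferInstance
  instFintypeProd _ _

/-- The answer of the challenger, who holds the challenge bit `b`. -/
def answer {D : System} (lam : ℕ) (K : PaillierKey) (b : Bool) (tape : Tape D lam K.N) :
    Query D → Answer D lam K.N
  | .compromise (some i) => .agentKey (tape.1 i)
  | .compromise none => .aggKey (secretKey K) (aggShares tape.1)
  | .encrypt i t W x => .ciphers fun β =>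
      let r := tape.2.1 i t β
      enc lam K.N (initW lam K.N (W β) r.1) (tape.1 i) t x r.2
  | .challenge ch => .challenge fun i =>
      let r := tape.2.2 i
      if some i ∈ ch.S then
        some (enc lam K.N (initW lam K.N (ch.W b i) r.1) (tape.1 i) ch.t (ch.x b i) r.2)
      else none

/-- The interaction: at most the given number of further queries, starting from a view. -/
def run {D : System} {lam : ℕ} (A : Adversary D lam) (ω : A.Coins) (K : PaillierKey) (b : Bool)
    (tape : Tape D lam K.N) : ℕ → History D lam K.N → History D lam K.N
  | 0, h => h
  | k + 1, h =>
    match A.next ω K.N h with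
    | none => h
    | some q => run A ω K b tape k (h ++ [(q, answer lam K b tape q)])

namespace Query

variable {D : System}

/-- The agent and time step of an encryption query. -/
def encIndex? : Query D → Option (Fin D.M × Fin D.T)
  | .encrypt i t _ _ => some (i, t)
  | _ => none

/-- The challenge, if the query is one. -/
def challenge? : Query D → Option (Challenge D)
  | .challenge ch => some ch
  | _ => none

/-- The query uses, for each agent that it involves, the given two weight matrices. -/
def UsesWeights (W : Bool → ∀ i, D.Weights i) : Query D → Prop
  | .compromise _ => True
  | .encrypt i _ W' _ => ∀ β, W' β = W β i
  | .challenge ch => ∀ i, some i ∈ ch.S → ∀ β, ch.W β i = W β i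

end Query

/-- `U*`: the participants that were not compromised in the whole game and for which no encryption
query was made at time `t`. -/
def uncorrupted {D : System} (qs : List (Query D)) (t : Fin D.T) : Set (Option (Fin D.M)) :=
  {j | Query.compromise j ∉ qs ∧ ∀ i, j = some i → (i, t) ∉ qs.filterMap Query.encIndex?}

/-- The rules of the game, for the list of all queries made: at most one encryption query for each
agent and time step; weights that are constant over the game; exactly one challenge; its set
satisfies `S* ⊆ U*`; and if `S* = U*` and the aggregator is not in `S*`, then the two challenge series
have the same aggregate. -/
def Legitimate {D : System} (qs : List (Query D)) : Prop :=
  (qs.filterMap Query.encIndex?).Nodup ∧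
  (∃ W : Bool → ∀ i, D.Weights i, ∀ q ∈ qs, q.UsesWeights W) ∧
  ∃ ch : Challenge D, qs.filterMap Query.challenge? = [ch] ∧
    (ch.S : Set (Option (Fin D.M))) ⊆ uncorrupted qs ch.t ∧
    ((ch.S : Set (Option (Fin D.M))) = uncorrupted qs ch.t → none ∉ ch.S →
      (∑ i with some i ∈ ch.S, System.apply (ch.W false i) (ch.x false i)) =
        ∑ i with some i ∈ ch.S, System.apply (ch.W true i) (ch.x true i))

open Classical in
/-- The game; the outcome `true` means that the guess is right. If the adversary breaks the rules, a
fair coin replaces its guess. -/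
noncomputable def game {D : System} {lam : ℕ} (gen : PMF PaillierKey) (A : Adversary D lam) :
    PMF Bool :=
  gen.bind fun K =>
  (PMF.uniformOfFintype Bool).bind fun b =>
  (PMF.uniformOfFintype (Tape D lam K.N)).bind fun tape =>
  A.coins.bind fun ω =>
    let h := run A ω K b tape A.steps []
    if Legitimate (h.map Prod.fst) then PMF.pure (A.guess ω K.N h == b)
    else PMF.uniformOfFintype Bool

/-- `|Pr[b' = b] - 1/2|`. -/
noncomputable def advantage {D : System} {lam : ℕ} (gen : PMF PaillierKey) (A : Adversary D lam) :
    ℝ :=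
  |(game gen A true).toReal - 1 / 2|

/-- Negligible functions. -/
def Negligible (f : ℕ → ℝ) : Prop :=
  ∀ c : ℝ, 0 < c → ∃ n₀ : ℕ, 1 ≤ n₀ ∧ ∀ n : ℕ, n₀ ≤ n → |f n| ≤ (n : ℝ) ^ (-c)

/-- Weighted sum aggregator obliviousness: no family of adversaries, whatever its running time, has
more than a negligible advantage. In particular, no probabilistic polynomial-time one has. -/
def AggregatorOblivious (D : System) (gen : ℕ → PMF PaillierKey) (lam : ℕ → ℕ) : Prop :=
  ∀ A : ∀ κ, Adversary D (lam κ), Negligible fun κ => advantage (gen κ) (A κ)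

end PackedWSA

open PackedWSA

/-!
Correctness: slot `k` of the decrypted sum holds `∑ i, (∑ c, W̃ᵢ x̃ᵢ + sᵢ + 2 ^ γ zᵢ) + s_a`. The
slot width `δ` leaves room for it, and modulo `2 ^ γ` the offsets, the noise and the shares
vanish, so that the small integer `∑ i, W̄ᵢ x̄ᵢ` remains.

Obliviousness is statistical. A ciphertext depends only on the slots `W̃ x̃ + μ`, where
`μ = s + 2 ^ γ z`, and on a uniform unit. For fixed keys, adversary coins and transcript there is
an injection on the challenger's coins after which the bit `!b` produces the answers that `b`
produced before: `μ` moves by the difference of the two products `W̃ x̃`, the share taking the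
residue modulo `2 ^ γ` and the noise `z` the carry. The aggregator's share is unchanged if the
shifts of the shares sum to zero. They do if the two aggregates agree; otherwise an uncorrupted
agent outside `S*` absorbs the sum, or the aggregator is not compromised. The injection works
unless some `z` lies within `3 nᵢ 2 ^ l` of an end of its range, which has probability at most
`3 · 2 ^ (-λ)` for each slot.
-/

namespace PackedWSA

theorem natCast_pow_eq_of_natCast_eq {N a b : ℕ} (h : (a : ZMod N) = b) :
    (a : ZMod (N ^ 2)) ^ N = (b : ZMod (N ^ 2)) ^ N := by
  have hab : (N : ℤ) ∣ (a : ℤ) - b := by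
    rw [← ZMod.intCast_zmod_eq_zero_iff_dvd]
    push_cast
    rw [h, sub_self]
  have hpow : ((N ^ 2 : ℕ) : ℤ) ∣ (a : ℤ) ^ N - (b : ℤ) ^ N := by
    simpa using dvd_sub_pow_of_dvd_sub hab 1
  rw [← ZMod.intCast_zmod_eq_zero_iff_dvd] at hpow
  push_cast at hpow
  exact sub_eq_zero.mp hpow

theorem encryptP_zero_one (N : ℕ) [NeZero N] : encryptP N 0 1 = 1 := by
  have h : (((1 : (ZMod N)ˣ) : ZMod N).val : ZMod (N ^ 2)) ^ N = ((1 : ℕ) : ZMod (N ^ 2)) ^ N :=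
    natCast_pow_eq_of_natCast_eq (by simp)
  rw [encryptP, h]
  simp

theorem encryptP_mul {N : ℕ} [NeZero N] (x y : ℕ) (r s : (ZMod N)ˣ) :
    encryptP N x r * encryptP N y s = encryptP N (x + y) (r * s) := by
  have h : (((r * s : (ZMod N)ˣ) : ZMod N).val : ZMod (N ^ 2)) ^ N =
      ((r : ZMod N).val : ZMod (N ^ 2)) ^ N * ((s : ZMod N).val : ZMod (N ^ 2)) ^ N := by
    rw [← mul_pow, ← Nat.cast_mul]
    exact natCast_pow_eq_of_natCast_eq (by simp)
  rw [encryptP, encryptP, encryptP, h, pow_add]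
  ring

/-- Paillier encryption as a homomorphism from plaintexts and randomness to ciphertexts, for which
powers and products of ciphertexts are instances of `map_pow` and `map_prod`. -/
def encryptHom (N : ℕ) [NeZero N] : Multiplicative ℕ × (ZMod N)ˣ →* ZMod (N ^ 2) where
  toFun c := encryptP N c.1.toAdd c.2
  map_one' := encryptP_zero_one N
  map_mul' c c' := (encryptP_mul c.1.toAdd c'.1.toAdd c.2 c'.2).symm

theorem encryptP_pow {N : ℕ} [NeZero N] (x : ℕ) (r : (ZMod N)ˣ) (k : ℕ) :
    encryptP N x r ^ k = encryptP N (x * k) (r ^ k) := by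
  simpa [encryptHom, mul_comm] using
    (map_pow (encryptHom N) (Multiplicative.ofAdd x, r) k).symm

theorem encryptP_prod {N : ℕ} [NeZero N] {ι : Type*} (s : Finset ι) (x : ι → ℕ)
    (r : ι → (ZMod N)ˣ) :
    ∏ i ∈ s, encryptP N (x i) (r i) = encryptP N (∑ i ∈ s, x i) (∏ i ∈ s, r i) := by
  have h := map_prod (encryptHom N) (fun i => (Multiplicative.ofAdd (x i), r i)) s
  simpa only [encryptHom, MonoidHom.coe_mk, OneHom.coe_mk, Prod.fst_prod, Prod.snd_prod,
    toAdd_prod, toAdd_ofAdd] using h.symm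

theorem one_add_natCast_pow (N m : ℕ) :
    (1 + (N : ZMod (N ^ 2))) ^ m = ((1 + m * N : ℕ) : ZMod (N ^ 2)) := by
  have hsq : (N : ZMod (N ^ 2)) * N = 0 := by
    rw [← pow_two, ← Nat.cast_pow, ZMod.natCast_self]
  induction m with
  | zero => simp
  | succ m ih =>
    rw [pow_succ (1 + (N : ZMod (N ^ 2))) m, ih]
    push_cast
    linear_combination (m : ZMod (N ^ 2)) * hsq

theorem val_pow_pow_totient (N : ℕ) [NeZero N] (r : (ZMod N)ˣ) :
    (((r : ZMod N).val : ZMod (N ^ 2)) ^ N) ^ Nat.totient N = 1 := by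
  have h : (((r : ZMod N).val ^ Nat.totient N : ℕ) : ZMod N) = (1 : ℕ) := by
    rw [Nat.cast_pow, ZMod.natCast_zmod_val, ← Units.val_pow_eq_pow_val, ZMod.pow_totient]
    simp
  rw [← pow_mul, mul_comm, pow_mul, ← Nat.cast_pow, natCast_pow_eq_of_natCast_eq h, Nat.cast_one,
    one_pow]

theorem encryptP_pow_totient (N : ℕ) [NeZero N] (x : ℕ) (r : (ZMod N)ˣ) :
    encryptP N x r ^ Nat.totient N =
      ((1 + x * Nat.totient N % N * N : ℕ) : ZMod (N ^ 2)) := by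
  rw [encryptP, mul_pow, val_pow_pow_totient, mul_one, ← pow_mul, one_add_natCast_pow,
    ZMod.natCast_eq_natCast_iff, pow_two]
  exact ((Nat.mod_modEq _ _).mul_right' N).symm.add_left 1

theorem decryptP_encryptP (K : PaillierKey) (x : ℕ) (r : (ZMod K.N)ˣ) :
    decryptP K.N (secretKey K) (encryptP K.N x r) = x := by
  have hN : 2 ≤ K.N := by simpa [PaillierKey.N] using Nat.mul_le_mul K.hp.two_le K.hq.one_le
  have hlt : 1 + x * Nat.totient K.N % K.N * K.N < K.N ^ 2 := by
    have : x * Nat.totient K.N % K.N + 1 ≤ K.N := Nat.mod_lt _ (by omega)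
    nlinarith
  simp only [decryptP, secretKey]
  rw [encryptP_pow_totient, ZMod.val_natCast_of_lt hlt, Nat.add_sub_cancel_left,
    Nat.mul_div_cancel _ (by omega), ZMod.natCast_mod, Nat.cast_mul, mul_assoc,
    ZMod.coe_mul_inv_eq_one (n := K.N) (Nat.totient K.N) K.coprime, mul_one]

section Packing

variable (D : System) (lam N : ℕ)

theorem capacity_pos : 0 < capacity D lam N :=
  Nat.one_pos.trans_le (le_max_left _ _)

/-- `pack` as a linear map, so that it commutes with sums and scalar multiples. -/
def packLinear (β : Fin (blocks D lam N)) : (Fin D.na → ℕ) →ₗ[ℕ] ℕ where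
  toFun y := pack D lam N y β
  map_add' y z := by simp [pack, ← Finset.sum_add_distrib, add_mul, ite_add_ite]
  map_smul' a y := by simp [pack, Finset.mul_sum, mul_assoc]

@[simp]
theorem packLinear_apply (β : Fin (blocks D lam N)) (y : Fin D.na → ℕ) :
    packLinear D lam N β y = pack D lam N y β := rfl

/-- The slot that holds entry `k`, as a pair of a plaintext and a position in it. -/
def slotIndex (k : Fin D.na) : Fin (blocks D lam N) × Fin (capacity D lam N) :=
  (blockOf D lam N k, ⟨slotOf D lam N k, Nat.mod_lt _ (capacity_pos D lam N)⟩)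

theorem slotIndex_injective : Function.Injective (slotIndex D lam N) := by
  intro k k' h
  obtain ⟨hblock, hslot⟩ := Prod.ext_iff.mp h
  have hdiv : k.1 / capacity D lam N = k'.1 / capacity D lam N := congrArg Fin.val hblock
  have hmod : k.1 % capacity D lam N = k'.1 % capacity D lam N := congrArg Fin.val hslot
  rw [Fin.ext_iff, ← Nat.div_add_mod k.1 (capacity D lam N), hdiv, hmod, Nat.div_add_mod]

variable {D lam N}

/-- The digits of the plaintext `pack y β` in base `2 ^ δ`; unused slots hold `0`. -/
noncomputable def slotDigits {y : Fin D.na → ℕ} (hy : ∀ k, y k < 2 ^ D.del lam)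
    (β : Fin (blocks D lam N)) (j : Fin (capacity D lam N)) : Fin (2 ^ D.del lam) :=
  Function.extend (slotIndex D lam N) (fun k => ⟨y k, hy k⟩) 0 (β, j)

theorem slotDigits_slotIndex {y : Fin D.na → ℕ} (hy : ∀ k, y k < 2 ^ D.del lam) (k : Fin D.na) :
    slotDigits hy (blockOf D lam N k) (slotIndex D lam N k).2 = ⟨y k, hy k⟩ :=
  (slotIndex_injective D lam N).extend_apply _ _ k

theorem pack_eq_finFunctionFinEquiv {y : Fin D.na → ℕ} (hy : ∀ k, y k < 2 ^ D.del lam)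
    (β : Fin (blocks D lam N)) :
    pack D lam N y β = (finFunctionFinEquiv (slotDigits hy β)).val := by
  rw [finFunctionFinEquiv_apply, pack, ← Finset.sum_filter]
  refine Finset.sum_of_injOn (fun k => (slotIndex D lam N k).2) ?_ (by simp [Set.MapsTo]) ?_ ?_
  · intro k hk k' hk' h
    simp only [Finset.coe_filter_univ, Set.mem_ofPred_eq] at hk hk'
    exact slotIndex_injective D lam N (Prod.ext (hk.trans hk'.symm) h)
  · intro j _ hj
    have hunused : ¬∃ k, slotIndex D lam N k = (β, j) := by
      rintro ⟨k, hk⟩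
      exact hj ⟨k, by simpa [slotIndex] using congrArg Prod.fst hk, congrArg Prod.snd hk⟩
    simp [slotDigits, Function.extend_apply' _ _ _ hunused]
  · intro k hk
    obtain rfl : blockOf D lam N k = β := by simpa using hk
    rw [slotDigits_slotIndex, ← pow_mul, mul_comm (D.del lam)]
    rfl

theorem unpack_pack {y : Fin D.na → ℕ} (hy : ∀ k, y k < 2 ^ D.del lam) (k : Fin D.na) :
    unpack D lam N (pack D lam N y) k = y k := by
  have h := congrFun (finFunctionFinEquiv.symm_apply_apply (slotDigits hy (blockOf D lam N k)))
    (slotIndex D lam N k).2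
  rw [Fin.ext_iff, finFunctionFinEquiv_symm_apply_val, ← pack_eq_finFunctionFinEquiv,
    ← pow_mul, mul_comm (D.del lam)] at h
  exact h.trans (congrArg Fin.val (slotDigits_slotIndex hy k))

theorem pack_lt {y : Fin D.na → ℕ} (hN : N ≠ 0) (hdel : D.del lam ≤ Nat.log 2 N)
    (hy : ∀ k, y k < 2 ^ D.del lam) (β : Fin (blocks D lam N)) : pack D lam N y β < N := by
  have hpos : 0 < D.del lam := by unfold System.del; omega
  have hcap : capacity D lam N = Nat.log 2 N / D.del lam :=
    max_eq_right ((Nat.one_le_div_iff hpos).mpr hdel)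
  calc pack D lam N y β = (finFunctionFinEquiv (slotDigits hy β)).val :=
        pack_eq_finFunctionFinEquiv hy β
    _ < (2 ^ D.del lam) ^ capacity D lam N := Fin.is_lt _
    _ = 2 ^ (D.del lam * (Nat.log 2 N / D.del lam)) := by rw [← pow_mul, hcap]
    _ ≤ 2 ^ Nat.log 2 N := Nat.pow_le_pow_right two_pos (Nat.mul_div_le _ _)
    _ ≤ N := Nat.pow_log_le_self 2 hN

end Packing

section FixedPoint

variable {D : System}

theorem two_mul_l_lt_gam (D : System) : 2 * D.l < D.gam := by
  unfold System.gam
  omega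

theorem two_pow_l_le_two_pow_gam (D : System) : (2 : ℤ) ^ D.l ≤ 2 ^ D.gam :=
  pow_le_pow_right₀ one_le_two (by have := two_mul_l_lt_gam D; omega)

theorem two_pow_gam_eq_zero : (2 : ZMod (2 ^ D.gam)) ^ D.gam = 0 := by
  exact_mod_cast ZMod.natCast_self (2 ^ D.gam)

theorem cast_bar (y : D.FixedPt) : (System.bar y : ℚ) = y.1 * 2 ^ D.lf := by
  obtain ⟨a, -, -, ha⟩ := y.2
  rw [System.bar, ha, Int.floor_intCast]

theorem abs_two_mul_bar_le (y : D.FixedPt) : |2 * System.bar y| ≤ 2 ^ D.l := by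
  obtain ⟨a, hlower, hupper, ha⟩ := y.2
  rw [System.bar, ha, Int.floor_intCast, abs_le]
  exact ⟨hlower, hupper.le⟩

theorem tilde_eq (y : D.FixedPt) : (System.tilde y : ℤ) = System.bar y + 2 ^ D.gam := by
  have := abs_le.mp (abs_two_mul_bar_le y)
  have := two_pow_l_le_two_pow_gam D
  exact Int.toNat_of_nonneg (by omega)

theorem tilde_le (y : D.FixedPt) : System.tilde y ≤ 2 ^ (D.gam + 1) := by
  have := abs_le.mp (abs_two_mul_bar_le y)
  have := two_pow_l_le_two_pow_gam D
  zify
  rw [tilde_eq, pow_succ]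
  omega

theorem tilde_cast (y : D.FixedPt) : (System.tilde y : ZMod (2 ^ D.gam)) = System.bar y := by
  have h := congrArg (Int.cast : ℤ → ZMod (2 ^ D.gam)) (tilde_eq y)
  push_cast at h
  rw [h, two_pow_gam_eq_zero, add_zero]

theorem n_le_two_pow_clog_nMax (D : System) (i : Fin D.M) : D.n i ≤ 2 ^ Nat.clog 2 D.nMax :=
  (Finset.le_sup (f := D.n) (Finset.mem_univ i)).trans (Nat.le_pow_clog one_lt_two _)

variable {i : Fin D.M}

/-- The product `W̄ x̄` of the integer representatives of the data. -/
def barProduct (W : D.Weights i) (x : D.Data i) (k : Fin D.na) : ℤ :=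
  ∑ c, System.bar (W k c) * System.bar (x c)

/-- The product `W̃ x̃` of the nonnegative representatives of the data. -/
def offsetProduct (W : D.Weights i) (x : D.Data i) (k : Fin D.na) : ℕ :=
  ∑ c, System.tilde (W k c) * System.tilde (x c)

theorem barProduct_eq (W : D.Weights i) (x : D.Data i) (k : Fin D.na) :
    (barProduct W x k : ℚ) = System.apply W x k * 2 ^ (2 * D.lf) := by
  simp only [barProduct, System.apply, Matrix.mulVec, dotProduct, Matrix.map_apply, Int.cast_sum,
    Int.cast_mul, cast_bar, Finset.sum_mul]
  exact Finset.sum_congr rfl fun c _ => by ring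

theorem abs_barProduct_le (W : D.Weights i) (x : D.Data i) (k : Fin D.na) :
    4 * |barProduct W x k| ≤ D.n i * 2 ^ (2 * D.l) :=
  calc 4 * |barProduct W x k|
      ≤ ∑ c, 4 * |System.bar (W k c) * System.bar (x c)| := by
        rw [← Finset.mul_sum]
        exact mul_le_mul_of_nonneg_left (Finset.abs_sum_le_sum_abs _ _) (by norm_num)
    _ = ∑ c, |2 * System.bar (W k c)| * |2 * System.bar (x c)| := by
        refine Finset.sum_congr rfl fun c _ => ?_
        simp only [abs_mul, Nat.abs_ofNat]
        ring
    _ ≤ ∑ _c : Fin (D.n i), 2 ^ D.l * 2 ^ D.l := by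
        gcongr <;> exact abs_two_mul_bar_le _
    _ = D.n i * 2 ^ (2 * D.l) := by simp [two_mul, pow_add]

theorem offsetProduct_le (W : D.Weights i) (x : D.Data i) (k : Fin D.na) :
    offsetProduct W x k ≤ 2 ^ (Nat.clog 2 D.nMax + 2 * (D.gam + 1)) :=
  calc offsetProduct W x k
      ≤ ∑ _c : Fin (D.n i), 2 ^ (D.gam + 1) * 2 ^ (D.gam + 1) := by
        unfold offsetProduct
        gcongr <;> exact tilde_le _
    _ = D.n i * 2 ^ (2 * (D.gam + 1)) := by simp [two_mul, pow_add]
    _ ≤ 2 ^ (Nat.clog 2 D.nMax + 2 * (D.gam + 1)) := by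
        rw [pow_add _ (Nat.clog 2 D.nMax)]
        exact Nat.mul_le_mul_right _ (n_le_two_pow_clog_nMax D i)

theorem offsetProduct_cast (W : D.Weights i) (x : D.Data i) (k : Fin D.na) :
    (offsetProduct W x k : ZMod (2 ^ D.gam)) = barProduct W x k := by
  simp only [offsetProduct, barProduct, Nat.cast_sum, Nat.cast_mul, tilde_cast, Int.cast_sum,
    Int.cast_mul]

theorem abs_sum_barProduct_le (W : ∀ i, D.Weights i) (x : ∀ i, D.Data i) (k : Fin D.na) :
    4 * |∑ i, barProduct (W i) (x i) k| ≤ 2 ^ (D.gam - 1) :=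
  calc 4 * |∑ i, barProduct (W i) (x i) k|
      ≤ ∑ i, 4 * |barProduct (W i) (x i) k| := by
        rw [← Finset.mul_sum]
        exact mul_le_mul_of_nonneg_left (Finset.abs_sum_le_sum_abs _ _) (by norm_num)
    _ ≤ ∑ _i : Fin D.M, 2 ^ Nat.clog 2 D.nMax * 2 ^ (2 * D.l) := by
        refine Finset.sum_le_sum fun i _ => (abs_barProduct_le _ _ _).trans ?_
        gcongr
        exact_mod_cast n_le_two_pow_clog_nMax D i
    _ = D.M * (2 ^ Nat.clog 2 D.nMax * 2 ^ (2 * D.l)) := by simp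
    _ ≤ 2 ^ Nat.clog 2 D.M * (2 ^ Nat.clog 2 D.nMax * 2 ^ (2 * D.l)) := by
        gcongr
        exact_mod_cast Nat.le_pow_clog one_lt_two D.M
    _ = 2 ^ (D.gam - 1) := by
        rw [← pow_add, ← pow_add]
        congr 1
        unfold System.gam
        omega

end FixedPoint

section Correctness

variable {D : System} {lam N : ℕ} {i : Fin D.M}

/-- The summand `W̃ x̃ + s + 2 ^ γ z` of an agent in each slot of the aggregate. -/
def slotValue (W : D.Weights i) (x : D.Data i) (s : Fin D.na → ZMod (2 ^ D.gam))
    (z : Fin D.na → Fin (2 ^ D.noiseBits lam i)) (k : Fin D.na) : ℕ :=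
  offsetProduct W x k + ((s k).val + 2 ^ D.gam * (z k).val)

theorem slotValue_cast (W : D.Weights i) (x : D.Data i) (s : Fin D.na → ZMod (2 ^ D.gam))
    (z : Fin D.na → Fin (2 ^ D.noiseBits lam i)) (k : Fin D.na) :
    (slotValue W x s z k : ZMod (2 ^ D.gam)) = barProduct W x k + s k := by
  simp only [slotValue, Nat.cast_add, Nat.cast_mul, Nat.cast_pow, Nat.cast_ofNat,
    two_pow_gam_eq_zero, zero_mul, add_zero, ZMod.natCast_zmod_val, offsetProduct_cast]

theorem slotValue_le (W : D.Weights i) (x : D.Data i) (s : Fin D.na → ZMod (2 ^ D.gam))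
    (z : Fin D.na → Fin (2 ^ D.noiseBits lam i)) (k : Fin D.na) :
    slotValue W x s z k ≤ 2 ^ (Nat.clog 2 D.nMax + 2 * (D.gam + 1)) +
      2 ^ (D.gam + (D.l + 1 + lam + Nat.clog 2 D.nMax)) := by
  refine Nat.add_le_add (offsetProduct_le W x k) ?_
  have hclog : Nat.clog 2 (D.n i) ≤ Nat.clog 2 D.nMax :=
    Nat.clog_mono_right 2 (Finset.le_sup (f := D.n) (Finset.mem_univ i))
  calc (s k).val + 2 ^ D.gam * (z k).val
      ≤ 2 ^ D.gam * ((z k).val + 1) := by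
        rw [mul_add_one, add_comm]
        exact Nat.add_le_add_left (ZMod.val_lt (s k)).le _
    _ ≤ 2 ^ D.gam * 2 ^ D.noiseBits lam i := Nat.mul_le_mul_left _ (z k).2
    _ ≤ 2 ^ (D.gam + (D.l + 1 + lam + Nat.clog 2 D.nMax)) := by
        rw [← pow_add]
        refine Nat.pow_le_pow_right two_pos ?_
        unfold System.noiseBits
        omega

theorem sum_slotValue_add_lt (W : ∀ i, D.Weights i) (x : ∀ i, D.Data i)
    (s : Fin D.M → Fin D.na → ZMod (2 ^ D.gam)) (sa : ZMod (2 ^ D.gam))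
    (z : ∀ i, Fin D.na → Fin (2 ^ D.noiseBits lam i)) (k : Fin D.na) :
    ∑ i, slotValue (W i) (x i) (s i) (z i) k + sa.val < 2 ^ D.del lam := by
  have hmax := le_max_left (D.l + 2 + Nat.clog 2 D.nMax + Nat.clog 2 D.M) lam
  have hmax' := le_max_right (D.l + 2 + Nat.clog 2 D.nMax + Nat.clog 2 D.M) lam
  have hpow {a : ℕ} (ha : a ≤ D.del lam - 2) : 2 ^ a ≤ 2 ^ (D.del lam - 2) :=
    Nat.pow_le_pow_right two_pos ha
  have hsum : ∑ i, slotValue (W i) (x i) (s i) (z i) k ≤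
      2 ^ (D.del lam - 2) + 2 ^ (D.del lam - 2) :=
    calc ∑ i, slotValue (W i) (x i) (s i) (z i) k
        ≤ D.M * (2 ^ (Nat.clog 2 D.nMax + 2 * (D.gam + 1)) +
            2 ^ (D.gam + (D.l + 1 + lam + Nat.clog 2 D.nMax))) := by
          simpa using Finset.sum_le_card_nsmul Finset.univ _ _ fun i _ =>
            slotValue_le (W i) (x i) (s i) (z i) k
      _ ≤ 2 ^ Nat.clog 2 D.M * (2 ^ (Nat.clog 2 D.nMax + 2 * (D.gam + 1)) +
            2 ^ (D.gam + (D.l + 1 + lam + Nat.clog 2 D.nMax))) :=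
          Nat.mul_le_mul_right _ (Nat.le_pow_clog one_lt_two _)
      _ ≤ 2 ^ (D.del lam - 2) + 2 ^ (D.del lam - 2) := by
          rw [mul_add, ← pow_add, ← pow_add]
          refine Nat.add_le_add (hpow ?_) (hpow ?_) <;> unfold System.del System.gam <;> omega
  have hsa : sa.val < 2 ^ (D.del lam - 2) :=
    (ZMod.val_lt sa).trans_le (hpow (by unfold System.del System.gam; omega))
  have hdel : 2 ^ D.del lam = 2 ^ (D.del lam - 2) * 4 := by
    rw [← pow_sub_mul_pow 2 (show 2 ≤ D.del lam by unfold System.del; omega)]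
    rfl
  omega

theorem bmod_sum_slotValue_add (W : ∀ i, D.Weights i) (x : ∀ i, D.Data i)
    (s : Fin D.M → Fin D.na → ZMod (2 ^ D.gam))
    (z : ∀ i, Fin D.na → Fin (2 ^ D.noiseBits lam i)) (k : Fin D.na) :
    Int.bmod ((∑ i, slotValue (W i) (x i) (s i) (z i) k + (-∑ i, s i k).val : ℕ) : ℤ)
      (2 ^ D.gam) = ∑ i, barProduct (W i) (x i) k := by
  have hmod : (∑ i, slotValue (W i) (x i) (s i) (z i) k + (-∑ i, s i k).val : ℕ) ≡
      ∑ i, barProduct (W i) (x i) k [ZMOD ((2 ^ D.gam : ℕ) : ℤ)] := by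
    rw [← ZMod.intCast_eq_intCast_iff]
    simp [slotValue_cast, Finset.sum_add_distrib]
  have hsmall := abs_sum_barProduct_le W x k
  have hpow : (2 : ℤ) ^ D.gam = 2 ^ (D.gam - 1) * 2 :=
    (pow_sub_one_mul (by have := two_mul_l_lt_gam D; omega) 2).symm
  have hpos : (0 : ℤ) < 2 ^ (D.gam - 1) := by positivity
  have hlower := neg_abs_le (∑ i, barProduct (W i) (x i) k)
  have hupper := le_abs_self (∑ i, barProduct (W i) (x i) k)
  rw [← Int.emod_bmod, hmod, Int.emod_bmod]
  apply Int.bmod_eq_of_le_mul_two <;> push_cast <;> linarith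

theorem enc_initW [NeZero N] (W : D.Weights i) (rI : InitCoins D lam N i) (sk : Shares D)
    (t : Fin D.T) (x : D.Data i) (r : EncCoins D lam N i) (β : Fin (blocks D lam N)) :
    enc lam N (initW lam N W rI) sk t x r β =
      encryptP N (pack D lam N (slotValue W x (sk t) r.1) β)
        ((∏ c, rI c β ^ System.tilde (x c)) * r.2 β) := by
  have hvalue : slotValue W x (sk t) r.1 =
      ∑ c, System.tilde (x c) • (fun k => System.tilde (W k c)) +
        fun k => (sk t k).val + 2 ^ D.gam * (r.1 k).val := by
    ext k
    simp [slotValue, offsetProduct, Finset.sum_apply, mul_comm]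
  rw [← packLinear_apply, hvalue, map_add, map_sum, ← encryptP_mul, ← encryptP_prod]
  simp only [map_smul, packLinear_apply, smul_eq_mul, enc, initW, encryptP_pow, mul_comm]

theorem isCorrect (D : System) (gen : ℕ → PMF PaillierKey) (lam : ℕ → ℕ) :
    IsCorrect D gen lam := by
  intro κ K _ hdel s W rW t x r
  set Y : Fin D.na → ℕ := ∑ i, slotValue (W i) (x i) (s i t) (r i).1 with hY
  set S : Fin D.na → ℕ := fun k => (aggShares s t k).val
  have hlt (k : Fin D.na) : (Y + S) k < 2 ^ D.del (lam κ) := by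
    simpa only [hY, Pi.add_apply, Finset.sum_apply] using
      sum_slotValue_add_lt W x (fun i => s i t) (aggShares s t k) (fun i => (r i).1) k
  have hplain : (fun β => (decryptP K.N (secretKey K)
      (∏ i, enc (lam κ) K.N (initW (lam κ) K.N (W i) (rW i)) (s i) t (x i) (r i) β)).val +
        pack D (lam κ) K.N S β) = pack D (lam κ) K.N (Y + S) := by
    funext β
    have hYβ : pack D (lam κ) K.N Y β < K.N :=
      pack_lt (NeZero.ne _) hdel (fun k => (Nat.le_add_right _ _).trans_lt (hlt k)) β
    simp only [enc_initW, encryptP_prod, decryptP_encryptP]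
    simp only [← packLinear_apply, ← map_sum, ← hY] at hYβ ⊢
    rw [ZMod.val_natCast_of_lt hYβ, map_add]
  funext k
  have hmod := bmod_sum_slotValue_add W x (fun i => s i t) (fun i => (r i).1) k
  have hslot : (Y + S) k =
      ∑ i, slotValue (W i) (x i) (s i t) (r i).1 k + (-∑ i, s i t k).val := by
    simp only [hY, Pi.add_apply, Finset.sum_apply]
    rfl
  simp only [aggrDec]
  rw [hplain, unpack_pack hlt, hslot, hmod, div_eq_iff (by positivity), Finset.sum_apply,
    Finset.sum_mul, Int.cast_sum]
  exact Finset.sum_congr rfl fun i _ => barProduct_eq _ _ _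

end Correctness

section Rerandomization

/-- The quotient of `s + c` by the modulus, with `s` represented in `{0, …, m - 1}`. The noise
absorbs it when the mask `s` is changed by `c`. -/
def carry {m : ℕ} (s : ZMod m) (c : ℤ) : ℤ := (s.val + c) / m

theorem val_add_intCast_add_carry {m : ℕ} [NeZero m] (s : ZMod m) (c : ℤ) :
    ((s + c).val : ℤ) + m * carry s c = s.val + c := by
  have h : s + c = ((s.val + c : ℤ) : ZMod m) := by simp
  rw [h, ZMod.val_intCast, carry, Int.emod_add_mul_ediv]

theorem abs_carry_le {m : ℕ} [NeZero m] (s : ZMod m) {c : ℤ} {B : ℕ} (hc : |c| ≤ m * B) :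
    |carry s c| ≤ B := by
  have hm : (0 : ℤ) < m := by exact_mod_cast NeZero.pos m
  have hs : (s.val : ℤ) < m := by exact_mod_cast ZMod.val_lt s
  obtain ⟨hlower, hupper⟩ := abs_le.mp hc
  rw [abs_le, carry]
  refine ⟨(Int.le_ediv_iff_mul_le hm).mpr ?_, Int.lt_add_one_iff.mp (Int.ediv_lt_of_lt_mul hm ?_)⟩
  · nlinarith [s.val.cast_nonneg (α := ℤ)]
  · nlinarith

/-- `z` has distance at least `c` from both ends of its range. -/
def HasMargin {m : ℕ} (c : ℕ) (z : Fin m) : Prop := c ≤ z.val ∧ z.val + c < m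

open scoped Fin.IntCast in
theorem HasMargin.val_add_intCast {m : ℕ} [NeZero m] {B : ℕ} {z : Fin m} (hz : HasMargin B z)
    {c : ℤ} (hc : |c| ≤ B) : ((z + (c : Fin m)).val : ℤ) = z.val + c := by
  obtain ⟨hlower, hupper⟩ := hz
  have := abs_le.mp hc
  have hm : (m : ℤ) ≠ 0 := by exact_mod_cast NeZero.ne m
  rw [Fin.val_add, Fin.val_intCast, Int.natCast_emod, Nat.cast_add,
    Int.toNat_of_nonneg (Int.emod_nonneg c hm), Int.add_emod_emod]
  exact Int.emod_eq_of_lt (by omega) (by omega)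

variable {D : System} {lam N : ℕ} {i : Fin D.M}

/-- The change `W̃ x̃ - W̃' x̃'` of the offset product, which the mask `s + 2 ^ γ z` has to make up
for when `W', x'` replace `W, x`. -/
def offsetChange (W W' : D.Weights i) (x x' : D.Data i) (k : Fin D.na) : ℤ :=
  offsetProduct W x k - offsetProduct W' x' k

/-- A bound for the change of the noise of agent `i`. -/
def noiseMargin (D : System) (i : Fin D.M) : ℕ := 3 * D.n i * 2 ^ D.l

theorem abs_tilde_mul_tilde_sub_le (w x : D.FixedPt) :
    2 * |(System.tilde w * System.tilde x : ℤ) - 2 ^ D.gam * 2 ^ D.gam| ≤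
      2 ^ D.gam * (3 * 2 ^ D.l) := by
  have hl := two_pow_l_le_two_pow_gam D
  have hG : (0 : ℤ) < 2 ^ D.gam := by positivity
  have hw := abs_two_mul_bar_le w
  have hx := abs_two_mul_bar_le x
  have hprod : |2 * System.bar w| * |2 * System.bar x| ≤ 2 ^ D.l * 2 ^ D.l :=
    mul_le_mul hw hx (abs_nonneg _) (by positivity)
  have hexpand : 4 * ((System.tilde w * System.tilde x : ℤ) - 2 ^ D.gam * 2 ^ D.gam) =
      2 * 2 ^ D.gam * (2 * System.bar w) + 2 * 2 ^ D.gam * (2 * System.bar x) +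
        2 * System.bar w * (2 * System.bar x) := by
    rw [tilde_eq, tilde_eq]
    ring
  have habs := abs_add_three (2 * 2 ^ D.gam * (2 * System.bar w))
    (2 * 2 ^ D.gam * (2 * System.bar x)) (2 * System.bar w * (2 * System.bar x))
  rw [← hexpand, abs_mul 4, abs_mul (2 * 2 ^ D.gam), abs_mul (2 * 2 ^ D.gam),
    abs_mul (2 * System.bar w), abs_of_pos (a := 2 * 2 ^ D.gam) (by positivity),
    Nat.abs_ofNat] at habs
  linarith [mul_le_mul_of_nonneg_left hw hG.le, mul_le_mul_of_nonneg_left hx hG.le,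
    mul_le_mul_of_nonneg_right hl (pow_pos (zero_lt_two' ℤ) D.l).le,
    mul_pos hG (pow_pos (zero_lt_two' ℤ) D.l)]

theorem abs_offsetProduct_sub_le (W : D.Weights i) (x : D.Data i) (k : Fin D.na) :
    2 * |(offsetProduct W x k : ℤ) - D.n i * (2 ^ D.gam * 2 ^ D.gam)| ≤
      2 ^ D.gam * noiseMargin D i :=
  calc 2 * |(offsetProduct W x k : ℤ) - D.n i * (2 ^ D.gam * 2 ^ D.gam)|
      = 2 * |∑ c, ((System.tilde (W k c) * System.tilde (x c) : ℤ) - 2 ^ D.gam * 2 ^ D.gam)| := by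
        simp [offsetProduct, Finset.sum_sub_distrib]
    _ ≤ ∑ c, 2 * |(System.tilde (W k c) * System.tilde (x c) : ℤ) - 2 ^ D.gam * 2 ^ D.gam| := by
        rw [← Finset.mul_sum]
        exact mul_le_mul_of_nonneg_left (Finset.abs_sum_le_sum_abs _ _) (by norm_num)
    _ ≤ ∑ _c : Fin (D.n i), 2 ^ D.gam * (3 * 2 ^ D.l) :=
        Finset.sum_le_sum fun c _ => abs_tilde_mul_tilde_sub_le _ _
    _ = 2 ^ D.gam * noiseMargin D i := by
        simp only [Finset.sum_const, Finset.card_univ, Fintype.card_fin, nsmul_eq_mul, noiseMargin]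
        push_cast
        ring

theorem abs_offsetChange_le (W W' : D.Weights i) (x x' : D.Data i) (k : Fin D.na) :
    |offsetChange W W' x x' k| ≤ ((2 ^ D.gam : ℕ) : ℤ) * noiseMargin D i := by
  have h := abs_offsetProduct_sub_le W x k
  have h' := abs_offsetProduct_sub_le W' x' k
  have htri := abs_sub_le (offsetProduct W x k : ℤ) (D.n i * (2 ^ D.gam * 2 ^ D.gam))
    (offsetProduct W' x' k)
  rw [abs_sub_comm (D.n i * (2 ^ D.gam * 2 ^ D.gam) : ℤ)] at htri
  push_cast
  unfold offsetChange
  linarith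

theorem offsetChange_cast (W W' : D.Weights i) (x x' : D.Data i) (k : Fin D.na) :
    (offsetChange W W' x x' k : ZMod (2 ^ D.gam)) =
      (barProduct W x k : ZMod (2 ^ D.gam)) - barProduct W' x' k := by
  simp only [offsetChange, Int.cast_sub, Int.cast_natCast, offsetProduct_cast]

open scoped Fin.IntCast in
/-- The coins of agent `i` with which the second weights and data give the ciphertext of the first
ones, when the shares change from `s` by `offsetChange`. -/
def shiftCoins (W W' : D.Weights i) (x x' : D.Data i) (s : Fin D.na → ZMod (2 ^ D.gam))
    (r : InitCoins D lam N i × EncCoins D lam N i) : InitCoins D lam N i × EncCoins D lam N i :=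
  (r.1, fun k => r.2.1 k + (carry (s k) (offsetChange W W' x x' k) : Fin _),
    fun β => (∏ c, r.1 c β ^ System.tilde (x c)) / (∏ c, r.1 c β ^ System.tilde (x' c)) * r.2.2 β)

theorem shiftCoins_injective (W W' : D.Weights i) (x x' : D.Data i)
    (s : Fin D.na → ZMod (2 ^ D.gam)) :
    Function.Injective (shiftCoins (lam := lam) (N := N) W W' x x' s) := by
  rintro ⟨rI, z, u⟩ ⟨rI', z', u'⟩ h
  simp only [shiftCoins, Prod.mk.injEq] at h
  obtain ⟨rfl, hz, hu⟩ := h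
  obtain rfl : z = z' := funext fun k => add_right_cancel (congrFun hz k)
  obtain rfl : u = u' := funext fun β => mul_left_cancel (congrFun hu β)
  rfl

theorem slotValue_shiftCoins (W W' : D.Weights i) (x x' : D.Data i)
    (s : Fin D.na → ZMod (2 ^ D.gam)) (r : InitCoins D lam N i × EncCoins D lam N i)
    (hr : ∀ k, HasMargin (noiseMargin D i) (r.2.1 k)) :
    slotValue W' x' (fun k => s k + offsetChange W W' x x' k) (shiftCoins W W' x x' s r).2.1 =
      slotValue W x s r.2.1 := by
  funext k
  have hmask := val_add_intCast_add_carry (s k) (offsetChange W W' x x' k)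
  have hnoise := (hr k).val_add_intCast (abs_carry_le (s k) (abs_offsetChange_le W W' x x' k))
  zify [slotValue, shiftCoins]
  rw [hnoise]
  push_cast [offsetChange] at hmask ⊢
  linear_combination hmask

theorem enc_shiftCoins [NeZero N] (W W' : D.Weights i) (x x' : D.Data i) (sk sk' : Shares D)
    (t : Fin D.T) (r : InitCoins D lam N i × EncCoins D lam N i)
    (hsk : ∀ k, sk' t k = sk t k + offsetChange W W' x x' k)
    (hr : ∀ k, HasMargin (noiseMargin D i) (r.2.1 k)) :
    enc lam N (initW lam N W' (shiftCoins W W' x x' (sk t) r).1) sk' t x'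
        (shiftCoins W W' x x' (sk t) r).2 =
      enc lam N (initW lam N W r.1) sk t x r.2 := by
  funext β
  rw [enc_initW, enc_initW, funext hsk, slotValue_shiftCoins W W' x x' (sk t) r hr]
  congr 1
  simp only [shiftCoins]
  rw [← mul_assoc, mul_div_cancel]

end Rerandomization

section Coupling

variable {D : System} {lam N : ℕ}

/-- The change of the masks of the challenged agents when the other challenge is encrypted. -/
def challengeShift (b : Bool) (ch : Challenge D) (i : Fin D.M) : Fin D.na → ZMod (2 ^ D.gam) :=
  fun k => if some i ∈ ch.S then
    (offsetChange (ch.W b i) (ch.W (!b) i) (ch.x b i) (ch.x (!b) i) k : ZMod (2 ^ D.gam))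
  else 0

theorem sum_barProduct_congr {I : Finset (Fin D.M)} {W W' : ∀ i, D.Weights i}
    {x x' : ∀ i, D.Data i}
    (h : ∑ i ∈ I, System.apply (W i) (x i) = ∑ i ∈ I, System.apply (W' i) (x' i)) (k : Fin D.na) :
    ∑ i ∈ I, barProduct (W i) (x i) k = ∑ i ∈ I, barProduct (W' i) (x' i) k := by
  have hk := congrFun h k
  simp only [Finset.sum_apply] at hk
  rw [← Int.cast_inj (α := ℚ)]
  simp only [Int.cast_sum, barProduct_eq, ← Finset.sum_mul, hk]

theorem sum_challengeShift_eq_zero {ch : Challenge D}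
    (h : (∑ i with some i ∈ ch.S, System.apply (ch.W false i) (ch.x false i)) =
      ∑ i with some i ∈ ch.S, System.apply (ch.W true i) (ch.x true i)) (b : Bool) :
    ∑ i, challengeShift b ch i = 0 := by
  have hb : (∑ i with some i ∈ ch.S, System.apply (ch.W b i) (ch.x b i)) =
      ∑ i with some i ∈ ch.S, System.apply (ch.W (!b) i) (ch.x (!b) i) := by
    cases b
    · exact h
    · exact h.symm
  funext k
  simp only [challengeShift, ← Finset.sum_filter, Finset.sum_apply, Pi.zero_apply,
    offsetChange_cast, Finset.sum_sub_distrib, ← Int.cast_sum, sum_barProduct_congr hb, sub_self]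

/-- A change `d` of the shares at the time of the challenge that lets the answers for the bit `b` be
explained by the bit `!b`, without affecting the keys and ciphertexts that the adversary obtains by
the queries `qs`. -/
structure IsMaskShift (qs : List (Query D)) (b : Bool) (ch : Challenge D)
    (d : Fin D.M → Fin D.na → ZMod (2 ^ D.gam)) : Prop where
  challenged : ∀ i, some i ∈ ch.S → d i = challengeShift b ch i
  corrupted : ∀ i, some i ∉ uncorrupted qs ch.t → d i = 0
  aggregator : Query.compromise none ∈ qs → ∑ i, d i = 0

theorem exists_isMaskShift {qs : List (Query D)} {ch : Challenge D}
    (hS : (ch.S : Set (Option (Fin D.M))) ⊆ uncorrupted qs ch.t)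
    (hsum : (ch.S : Set (Option (Fin D.M))) = uncorrupted qs ch.t → none ∉ ch.S →
      (∑ i with some i ∈ ch.S, System.apply (ch.W false i) (ch.x false i)) =
        ∑ i with some i ∈ ch.S, System.apply (ch.W true i) (ch.x true i)) (b : Bool) :
    ∃ d, IsMaskShift qs b ch d := by
  have hcorrupted (i : Fin D.M) (hi : some i ∉ uncorrupted qs ch.t) :
      challengeShift b ch i = 0 :=
    funext fun _ => if_neg fun h => hi (hS h)
  by_cases hU : ∃ j, some j ∈ uncorrupted qs ch.t ∧ some j ∉ ch.S
  · -- An uncorrupted agent outside `S*` absorbs the sum of the other shifts.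
    obtain ⟨j, hjU, hjS⟩ := hU
    set d := challengeShift b ch + Pi.single j (-∑ i, challengeShift b ch i) with hd
    have hd_ne {i : Fin D.M} (hij : i ≠ j) : d i = challengeShift b ch i := by
      rw [hd, Pi.add_apply, Pi.single_eq_of_ne hij, add_zero]
    refine ⟨d, fun i hi => hd_ne ?_, fun i hi => (hd_ne ?_).trans (hcorrupted i hi), fun _ => ?_⟩
    · rintro rfl
      exact hjS hi
    · rintro rfl
      exact hi hjU
    · simp only [hd, Pi.add_apply, Finset.sum_add_distrib]
      rw [Finset.sum_pi_single', if_pos (Finset.mem_univ j), add_neg_cancel]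
  · refine ⟨challengeShift b ch, fun _ _ => rfl, hcorrupted, fun hagg => ?_⟩
    have hnone : none ∉ uncorrupted qs ch.t := fun h => h.1 hagg
    refine sum_challengeShift_eq_zero (hsum (hS.antisymm ?_) fun h => hnone (hS h)) b
    rintro (_ | j) hj
    · exact absurd hj hnone
    · by_contra hjS
      exact hU ⟨j, hj, hjS⟩

/-- The tape that explains, for the challenge bit `!b`, the answers given with the bit `b`. -/
def shiftTape (b : Bool) (ch : Challenge D) (d : Fin D.M → Fin D.na → ZMod (2 ^ D.gam))
    (tape : Tape D lam N) : Tape D lam N :=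
  (tape.1 + fun i => Pi.single ch.t (d i), tape.2.1,
    fun i => if some i ∈ ch.S then
      shiftCoins (ch.W b i) (ch.W (!b) i) (ch.x b i) (ch.x (!b) i) (tape.1 i ch.t) (tape.2.2 i)
    else tape.2.2 i)

theorem shiftTape_injective (b : Bool) (ch : Challenge D)
    (d : Fin D.M → Fin D.na → ZMod (2 ^ D.gam)) :
    Function.Injective (shiftTape (lam := lam) (N := N) b ch d) := by
  rintro ⟨s, e, r⟩ ⟨s', e', r'⟩ h
  simp only [shiftTape, Prod.mk.injEq] at h
  obtain ⟨hs, rfl, hr⟩ := h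
  obtain rfl : s = s' := add_right_cancel hs
  obtain rfl : r = r' := by
    funext i
    have hi := congrFun hr i
    split_ifs at hi
    · exact shiftCoins_injective _ _ _ _ _ hi
    · exact hi
  rfl

/-- The noise of all agents in the challenge is far from the ends of its range. -/
def NoiseInMargin (tape : Tape D lam N) : Prop :=
  ∀ i k, HasMargin (noiseMargin D i) ((tape.2.2 i).2.1 k)

theorem aggShares_add_single (s : SetupCoins D) (t : Fin D.T)
    {d : Fin D.M → Fin D.na → ZMod (2 ^ D.gam)} (hd : ∑ i, d i = 0) :
    aggShares (s + fun i => Pi.single t (d i)) = aggShares s := by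
  funext t' k
  have hk : ∑ i, (Pi.single t (d i) : Shares D) t' k = 0 := by
    rcases eq_or_ne t' t with rfl | ht
    · simpa using congrFun hd k
    · simp [Pi.single_eq_of_ne ht]
  simp only [aggShares, Pi.add_apply, Finset.sum_add_distrib, hk, add_zero]

theorem enc_congr_key {i : Fin D.M} (sw : Fin (D.n i) → Cipher D lam N) {sk sk' : Shares D}
    {t : Fin D.T} (h : sk t = sk' t) (x : D.Data i) (r : EncCoins D lam N i) :
    enc lam N sw sk t x r = enc lam N sw sk' t x r := by
  unfold enc
  rw [h]

section Answers

variable {qs : List (Query D)} {b : Bool} {ch : Challenge D}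
  {d : Fin D.M → Fin D.na → ZMod (2 ^ D.gam)} (hd : IsMaskShift qs b ch d) (K : PaillierKey)
  (tape : Tape D lam K.N)

include hd

theorem answer_shiftTape_compromise {j : Option (Fin D.M)} (hq : Query.compromise j ∈ qs) :
    answer lam K (!b) (shiftTape b ch d tape) (.compromise j) =
      answer lam K b tape (.compromise j) := by
  cases j with
  | none =>
    exact congrArg _ (aggShares_add_single tape.1 ch.t (hd.aggregator hq))
  | some i =>
    have hi : d i = 0 := hd.corrupted i fun h => h.1 hq
    simp only [answer, shiftTape, Pi.add_apply, hi, Pi.single_zero, add_zero]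

theorem answer_shiftTape_encrypt {i : Fin D.M} {t : Fin D.T} {W : Bool → D.Weights i}
    {x : D.Data i} (hq : Query.encrypt i t W x ∈ qs) :
    answer lam K (!b) (shiftTape b ch d tape) (.encrypt i t W x) =
      answer lam K b tape (.encrypt i t W x) := by
  have hkey : (shiftTape b ch d tape).1 i t = tape.1 i t := by
    simp only [shiftTape, Pi.add_apply]
    rcases eq_or_ne t ch.t with rfl | ht
    · have hi : d i = 0 := hd.corrupted i fun h =>
        h.2 i rfl (List.mem_filterMap.mpr ⟨_, hq, rfl⟩)
      rw [hi, Pi.single_zero, Pi.zero_apply, add_zero]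
    · rw [Pi.single_eq_of_ne ht, add_zero]
  exact congrArg _ (funext fun β => enc_congr_key _ hkey _ _)

theorem answer_shiftTape_challenge (htape : NoiseInMargin tape) :
    answer lam K (!b) (shiftTape b ch d tape) (.challenge ch) =
      answer lam K b tape (.challenge ch) := by
  refine congrArg Answer.challenge (funext fun i => ?_)
  by_cases hi : some i ∈ ch.S
  · have hkey (k : Fin D.na) : (shiftTape b ch d tape).1 i ch.t k = tape.1 i ch.t k +
        offsetChange (ch.W b i) (ch.W (!b) i) (ch.x b i) (ch.x (!b) i) k := by
      simp [shiftTape, hd.challenged i hi, challengeShift, hi]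
    have hcoins : (shiftTape b ch d tape).2.2 i = shiftCoins (ch.W b i) (ch.W (!b) i)
        (ch.x b i) (ch.x (!b) i) (tape.1 i ch.t) (tape.2.2 i) := if_pos hi
    simp only [if_pos hi, hcoins]
    exact congrArg some (enc_shiftCoins _ _ _ _ _ _ _ _ hkey (htape i))
  · simp only [if_neg hi]

theorem answer_shiftTape (hch : qs.filterMap Query.challenge? = [ch])
    (htape : NoiseInMargin tape) {q : Query D} (hq : q ∈ qs) :
    answer lam K (!b) (shiftTape b ch d tape) q = answer lam K b tape q := by
  cases q with
  | compromise j => exact answer_shiftTape_compromise hd K tape hq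
  | encrypt i t W x => exact answer_shiftTape_encrypt hd K tape hq
  | challenge ch' =>
    have hmem : ch' ∈ qs.filterMap Query.challenge? := List.mem_filterMap.mpr ⟨_, hq, rfl⟩
    obtain rfl : ch' = ch := by rwa [hch, List.mem_singleton] at hmem
    exact answer_shiftTape_challenge hd K tape htape

end Answers

theorem exists_tape_injection (K : PaillierKey) (b : Bool) (qs : List (Query D)) :
    ∃ Φ : Tape D lam K.N → Tape D lam K.N, Function.Injective Φ ∧
      (Legitimate qs → ∀ tape, NoiseInMargin tape → ∀ q ∈ qs,
        answer lam K (!b) (Φ tape) q = answer lam K b tape q) := by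
  by_cases h : Legitimate qs
  · obtain ⟨-, -, ch, hch, hS, hsum⟩ := h
    obtain ⟨d, hd⟩ := exists_isMaskShift hS hsum b
    exact ⟨shiftTape b ch d, shiftTape_injective b ch d, fun _ tape htape q hq =>
      answer_shiftTape hd K tape hch htape hq⟩
  · exact ⟨id, Function.injective_id, fun h' => absurd h' h⟩

theorem prefix_run (A : Adversary D lam) (ω : A.Coins) (K : PaillierKey) (b : Bool)
    (tape : Tape D lam K.N) (k : ℕ) (h : History D lam K.N) : h <+: run A ω K b tape k h := by
  induction k generalizing h with
  | zero => exact List.prefix_refl h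
  | succ k ih =>
    unfold run
    split
    · exact List.prefix_refl h
    · exact (List.prefix_append _ _).trans (ih _)

theorem run_congr (A : Adversary D lam) (ω : A.Coins) (K : PaillierKey) {b b' : Bool}
    {tape tape' : Tape D lam K.N} (k : ℕ) (h : History D lam K.N)
    (hanswer : ∀ q ∈ (run A ω K b tape k h).map Prod.fst,
      answer lam K b' tape' q = answer lam K b tape q) :
    run A ω K b' tape' k h = run A ω K b tape k h := by
  induction k generalizing h with
  | zero => rfl
  | succ k ih =>
    unfold run at hanswer ⊢
    cases hnext : A.next ω K.N h with
    | none => rfl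
    | some q =>
      simp only [hnext] at hanswer ⊢
      have hq : answer lam K b' tape' q = answer lam K b tape q :=
        hanswer q (List.mem_map_of_mem (f := Prod.fst)
          ((prefix_run A ω K b tape k _).subset (List.mem_append_right h List.mem_cons_self)))
      rw [hq]
      exact ih _ hanswer

theorem dens_filter_le_dens_filter_add_dens {α β : Type*} [Fintype α] {f g : α → β}
    {Φ : β → α → α} (hΦ : ∀ y, Function.Injective (Φ y)) {P : β → Prop} [DecidablePred P]
    {G : α → Prop} [DecidablePred G] (hfg : ∀ a, P (f a) → G a → g (Φ (f a) a) = f a) :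
    (Finset.univ.filter fun a => P (f a)).dens ≤
      (Finset.univ.filter fun a => P (g a)).dens + (Finset.univ.filter fun a => ¬G a).dens := by
  classical
  have hgood : (Finset.univ.filter fun a => P (f a) ∧ G a).dens ≤
      (Finset.univ.filter fun a => P (g a)).dens := by
    refine div_le_div_of_nonneg_right (Nat.cast_le.mpr
      (Finset.card_le_card_of_injOn (fun a => Φ (f a) a) (fun a ha => ?_)
        fun a ha a' ha' h => ?_)) zero_le
    · obtain ⟨-, hP, hG⟩ := Finset.mem_filter.mp ha
      simpa only [Finset.coe_filter, Finset.mem_univ, true_and, Set.mem_ofPred_eq, hfg a hP hG]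
    · obtain ⟨-, hP, hG⟩ := Finset.mem_filter.mp ha
      obtain ⟨-, hP', hG'⟩ := Finset.mem_filter.mp ha'
      -- `g` reads off which of the injections `Φ y` was applied.
      have hf : f a = f a' := by
        rw [← hfg a hP hG, ← hfg a' hP' hG']
        exact congrArg g h
      exact hΦ (f a) (by simpa only [hf] using h)
  calc (Finset.univ.filter fun a => P (f a)).dens
      ≤ ((Finset.univ.filter fun a => P (f a) ∧ G a) ∪ Finset.univ.filter fun a => ¬G a).dens :=
        Finset.dens_le_dens fun a => by simp only [Finset.mem_union, Finset.mem_filter]; tauto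
    _ ≤ _ := (Finset.dens_union_le _ _).trans (by gcongr)

open Classical in
theorem dens_run_le (A : Adversary D lam) (ω : A.Coins) (K : PaillierKey) (b : Bool)
    {P : History D lam K.N → Prop} [DecidablePred P] (hP : ∀ h, P h → Legitimate (h.map Prod.fst)) :
    (Finset.univ.filter fun tape => P (run A ω K b tape A.steps [])).dens ≤
      (Finset.univ.filter fun tape => P (run A ω K (!b) tape A.steps [])).dens +
        (Finset.univ.filter fun tape : Tape D lam K.N => ¬NoiseInMargin tape).dens := by
  choose Φ hΦ hanswer using exists_tape_injection (D := D) (lam := lam) K b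
  exact dens_filter_le_dens_filter_add_dens (Φ := fun h => Φ (h.map Prod.fst))
    (fun _ => hΦ _) fun tape hlegit htape =>
      run_congr A ω K A.steps [] (hanswer _ (hP _ hlegit) tape htape)

end Coupling

section NoiseProbability

theorem dens_filter_comp_eq_dens_filter {T Z : Type*} [Fintype T] [Nonempty T] [Fintype Z]
    {f : T → Z} (u : Z → T → T) (hf : ∀ z t, f (u z t) = z) (hu : ∀ z t, u (f t) (u z t) = t)
    (p : Z → Prop) [DecidablePred p] :
    (Finset.univ.filter fun t => p (f t)).dens = (Finset.univ.filter p).dens := by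
  have hcard : (Finset.univ.filter fun t => p (f t)).card * Fintype.card Z =
      (Finset.univ.filter p).card * Fintype.card T := by
    rw [← Fintype.card_subtype, ← Fintype.card_subtype, ← Fintype.card_prod, ← Fintype.card_prod]
    exact Fintype.card_congr
      { toFun := fun a => (⟨f a.1.1, a.1.2⟩, u a.2 a.1.1)
        invFun := fun a => (⟨u a.1.1 a.2, by rw [hf]; exact a.1.2⟩, f a.2)
        left_inv := fun a => by ext <;> simp [hf, hu]
        right_inv := fun a => by ext <;> simp [hf, hu] }
  have : Nonempty Z := Nonempty.map f ‹_›
  rw [Finset.dens, Finset.dens, div_eq_div_iff (by simp) (by simp)]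
  exact_mod_cast hcard

open Classical in
theorem dens_not_hasMargin_le (m c : ℕ) :
    (Finset.univ.filter fun z : Fin m => ¬HasMargin c z).dens ≤ 2 * c / m := by
  have hsub : (Finset.univ.filter fun z : Fin m => ¬HasMargin c z).map Fin.valEmbedding ⊆
      Finset.range c ∪ Finset.Ico (m - c) m := by
    intro v hv
    obtain ⟨z, hz, rfl⟩ := Finset.mem_map.mp hv
    have hz := (Finset.mem_filter.mp hz).2
    have := z.2
    simp only [HasMargin, Fin.valEmbedding_apply, Finset.mem_union, Finset.mem_range,
      Finset.mem_Ico] at hz ⊢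
    omega
  have hcard : (Finset.univ.filter fun z : Fin m => ¬HasMargin c z).card ≤ 2 * c := by
    rw [← Finset.card_map Fin.valEmbedding]
    refine (Finset.card_le_card hsub).trans ((Finset.card_union_le _ _).trans ?_)
    rw [Finset.card_range, Nat.card_Ico]
    omega
  rw [Finset.dens, Fintype.card_fin]
  gcongr
  exact_mod_cast hcard

variable {D : System} {lam : ℕ}

theorem two_mul_noiseMargin_div_le (i : Fin D.M) :
    2 * (noiseMargin D i : ℚ≥0) / (2 ^ D.noiseBits lam i : ℕ) ≤ 3 / 2 ^ lam := by
  have hn : (D.n i : ℚ≥0) ≤ 2 ^ Nat.clog 2 (D.n i) := by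
    exact_mod_cast Nat.le_pow_clog one_lt_two (D.n i)
  rw [div_le_div_iff₀ (by positivity) (by positivity)]
  calc 2 * (noiseMargin D i : ℚ≥0) * 2 ^ lam
      = 3 * (2 ^ (D.l + 1 + lam) * D.n i) := by
        push_cast [noiseMargin]
        ring
    _ ≤ 3 * (2 ^ (D.l + 1 + lam) * 2 ^ Nat.clog 2 (D.n i)) := by gcongr
    _ = 3 * (2 ^ D.noiseBits lam i : ℕ) := by
        rw [← pow_add, System.noiseBits]
        push_cast
        rfl

open Classical in
theorem dens_not_hasMargin_tape_le (N : ℕ) [NeZero N] (i : Fin D.M) (k : Fin D.na) :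
    (Finset.univ.filter fun tape : Tape D lam N =>
      ¬HasMargin (noiseMargin D i) ((tape.2.2 i).2.1 k)).dens ≤ 3 / 2 ^ lam :=
  calc (Finset.univ.filter fun tape : Tape D lam N =>
        ¬HasMargin (noiseMargin D i) ((tape.2.2 i).2.1 k)).dens
      = (Finset.univ.filter fun z : Fin (2 ^ D.noiseBits lam i) =>
          ¬HasMargin (noiseMargin D i) z).dens :=
        dens_filter_comp_eq_dens_filter (T := Tape D lam N)
          (f := fun tape => (tape.2.2 i).2.1 k)
          (fun z tape => (tape.1, tape.2.1, Function.update tape.2.2 i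
            ((tape.2.2 i).1, Function.update (tape.2.2 i).2.1 k z, (tape.2.2 i).2.2)))
          (fun z tape => by simp) (fun z tape => by simp)
          (fun z => ¬HasMargin (noiseMargin D i) z)
    _ ≤ 2 * noiseMargin D i / (2 ^ D.noiseBits lam i : ℕ) := dens_not_hasMargin_le _ _
    _ ≤ 3 / 2 ^ lam := two_mul_noiseMargin_div_le i

open Classical in
theorem dens_not_noiseInMargin_le (N : ℕ) [NeZero N] :
    (Finset.univ.filter fun tape : Tape D lam N => ¬NoiseInMargin tape).dens ≤
      D.M * D.na * (3 / 2 ^ lam) := by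
  have hunion : (Finset.univ.filter fun tape : Tape D lam N => ¬NoiseInMargin tape) =
      (Finset.univ : Finset (Fin D.M × Fin D.na)).biUnion fun a => Finset.univ.filter
        fun tape => ¬HasMargin (noiseMargin D a.1) ((tape.2.2 a.1).2.1 a.2) := by
    ext tape
    simp [NoiseInMargin]
  calc (Finset.univ.filter fun tape : Tape D lam N => ¬NoiseInMargin tape).dens
      ≤ ∑ a : Fin D.M × Fin D.na, (Finset.univ.filter fun tape : Tape D lam N =>
          ¬HasMargin (noiseMargin D a.1) ((tape.2.2 a.1).2.1 a.2)).dens :=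
        hunion ▸ Finset.dens_biUnion_le
    _ ≤ ∑ _a : Fin D.M × Fin D.na, 3 / 2 ^ lam :=
        Finset.sum_le_sum fun a _ => dens_not_hasMargin_tape_le N a.1 a.2
    _ = D.M * D.na * (3 / 2 ^ lam) := by simp

end NoiseProbability

section Probability

theorem abs_toReal_bind_apply_sub_le {α β : Type*} (p : PMF α) (f : α → PMF β) (y : β) {c ε : ℝ}
    (hf : ∀ a, |(f a y).toReal - c| ≤ ε) : |((p.bind f) y).toReal - c| ≤ ε := by
  have hmean (C : ENNReal) : ∑' a, p a * C = C := by
    rw [ENNReal.tsum_mul_right, PMF.tsum_coe, one_mul]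
  have hlower : ENNReal.ofReal (c - ε) ≤ (p.bind f) y := by
    rw [PMF.bind_apply, ← hmean (ENNReal.ofReal (c - ε))]
    refine ENNReal.tsum_le_tsum fun a => mul_le_mul_right ?_ _
    exact (ENNReal.ofReal_le_iff_le_toReal (PMF.apply_ne_top _ _)).mpr
      (by linarith [(abs_le.mp (hf a)).1])
  have hupper : (p.bind f) y ≤ ENNReal.ofReal (c + ε) := by
    rw [PMF.bind_apply, ← hmean (ENNReal.ofReal (c + ε))]
    refine ENNReal.tsum_le_tsum fun a => mul_le_mul_right ?_ _
    exact (ENNReal.le_ofReal_iff_toReal_le (PMF.apply_ne_top _ _) (by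
      linarith [(abs_le.mp (hf a)).2, ENNReal.toReal_nonneg (a := f a y)])).mpr
      (by linarith [(abs_le.mp (hf a)).2])
  obtain ⟨a, -⟩ := p.support_nonempty
  rw [ENNReal.ofReal_le_iff_le_toReal (PMF.apply_ne_top _ _)] at hlower
  rw [ENNReal.le_ofReal_iff_toReal_le (PMF.apply_ne_top _ _) (by
    linarith [(abs_le.mp (hf a)).2, ENNReal.toReal_nonneg (a := f a y)])] at hupper
  exact abs_le.mpr ⟨by linarith, by linarith⟩

theorem toReal_uniformOfFintype_bind_apply {α β : Type*} [Fintype α] [Nonempty α] (f : α → PMF β)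
    (y : β) : (((PMF.uniformOfFintype α).bind f) y).toReal = 𝔼 a, (f a y).toReal := by
  rw [PMF.bind_apply, tsum_fintype, ENNReal.toReal_sum fun a _ =>
    ENNReal.mul_ne_top (PMF.apply_ne_top _ _) (PMF.apply_ne_top _ _),
    Fintype.expect_eq_sum_div_card, Finset.sum_div]
  refine Finset.sum_congr rfl fun a _ => ?_
  rw [PMF.uniformOfFintype_apply, ENNReal.toReal_mul, ENNReal.toReal_inv, ENNReal.toReal_natCast,
    inv_mul_eq_div]

theorem expect_indicator_eq_dens {α : Type*} [Fintype α] (p : α → Prop) [DecidablePred p] :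
    𝔼 a, (if p a then 1 else 0 : ℝ) = ((Finset.univ.filter p).dens : ℝ) := by
  rw [Fintype.expect_eq_sum_div_card, Finset.sum_boole, Finset.dens]
  push_cast
  rfl

theorem toReal_guess_or_coin_true (valid : Prop) [Decidable valid] (guess b : Bool) :
    ((if valid then PMF.pure (guess == b) else PMF.uniformOfFintype Bool) true).toReal =
      1 / 2 + ((if valid ∧ guess = b then 1 else 0) -
        (if valid ∧ guess = !b then 1 else 0)) / 2 := by
  by_cases h : valid
  · cases guess <;> cases b <;> simp [h, PMF.pure_apply] <;> norm_num
  · simp [h, PMF.uniformOfFintype_apply]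

theorem abs_toReal_guessing_game_sub_half_le {α : Type*} [Fintype α] [Nonempty α]
    {valid : Bool → α → Prop} [∀ b, DecidablePred (valid b)] {guess : Bool → α → Bool} {ε : ℚ≥0}
    (h : ∀ b c, (Finset.univ.filter fun a => valid b a ∧ guess b a = c).dens ≤
      (Finset.univ.filter fun a => valid (!b) a ∧ guess (!b) a = c).dens + ε) :
    |(((PMF.uniformOfFintype Bool).bind fun b => (PMF.uniformOfFintype α).bind fun a =>
        if valid b a then PMF.pure (guess b a == b) else PMF.uniformOfFintype Bool) true).toReal -
      1 / 2| ≤ ε / 2 := by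
  set prob : Bool → Bool → ℝ := fun b c =>
    (Finset.univ.filter fun a => valid b a ∧ guess b a = c).dens with hprob
  have hle (b c : Bool) : prob b c ≤ prob (!b) c + ε := by
    simp only [hprob]
    exact_mod_cast h b c
  have hwin (b : Bool) : (((PMF.uniformOfFintype α).bind fun a =>
      if valid b a then PMF.pure (guess b a == b) else PMF.uniformOfFintype Bool) true).toReal =
      1 / 2 + (prob b b - prob b (!b)) / 2 := by
    simp only [toReal_uniformOfFintype_bind_apply, toReal_guess_or_coin_true,
      Finset.expect_add_distrib, ← Finset.expect_div, Finset.expect_sub_distrib,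
      expect_indicator_eq_dens, Fintype.expect_const, hprob]
  rw [toReal_uniformOfFintype_bind_apply, Fintype.expect_eq_sum_div_card, Fintype.sum_bool, hwin,
    hwin, Fintype.card_bool, abs_le]
  have htt := hle true true
  have htf := hle true false
  have hft := hle false true
  have hff := hle false false
  simp only [Bool.not_true, Bool.not_false, Nat.cast_ofNat] at *
  constructor <;> linarith

end Probability

section Advantage

variable {D : System} {lam : ℕ}

open Classical in
theorem abs_fixed_coins_game_sub_half_le (A : Adversary D lam) (ω : A.Coins) (K : PaillierKey) :
    |(((PMF.uniformOfFintype Bool).bind fun b =>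
        (PMF.uniformOfFintype (Tape D lam K.N)).bind fun tape =>
          if Legitimate ((run A ω K b tape A.steps []).map Prod.fst) then
            PMF.pure (A.guess ω K.N (run A ω K b tape A.steps []) == b)
          else PMF.uniformOfFintype Bool) true).toReal - 1 / 2| ≤
      3 * D.M * D.na / 2 * ((2 : ℝ) ^ lam)⁻¹ := by
  have hcouple (b c : Bool) := (dens_run_le A ω K b
    (P := fun h => Legitimate (h.map Prod.fst) ∧ A.guess ω K.N h = c) fun _ h => h.1).trans
      (add_le_add_right (dens_not_noiseInMargin_le K.N) _)
  refine (abs_toReal_guessing_game_sub_half_le hcouple).trans_eq ?_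
  push_cast
  ring

theorem advantage_le (gen : PMF PaillierKey) (A : Adversary D lam) :
    advantage gen A ≤ 3 * D.M * D.na / 2 * ((2 : ℝ) ^ lam)⁻¹ := by
  refine abs_toReal_bind_apply_sub_le _ _ _ fun K => ?_
  simp_rw [PMF.bind_comm (PMF.uniformOfFintype (Tape D lam K.N)) A.coins]
  rw [PMF.bind_comm (PMF.uniformOfFintype Bool) A.coins]
  exact abs_toReal_bind_apply_sub_le _ _ _ fun ω => abs_fixed_coins_game_sub_half_le A ω K

theorem Negligible.of_abs_le_const_mul {f g : ℕ → ℝ} (hg : Negligible g) (C : ℝ)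
    (hfg : ∀ n, |f n| ≤ C * |g n|) : Negligible f := by
  intro c hc
  obtain ⟨n₀, hn₀, hbound⟩ := hg (c + 1) (by linarith)
  refine ⟨max n₀ ⌈C⌉₊, hn₀.trans (le_max_left _ _), fun n hn => ?_⟩
  have hn₀n : n₀ ≤ n := (le_max_left _ _).trans hn
  have hCn : C ≤ n := Nat.ceil_le.mp ((le_max_right _ _).trans hn)
  have hpos : (0 : ℝ) < n := by exact_mod_cast hn₀.trans hn₀n
  calc |f n| ≤ C * |g n| := hfg n
    _ ≤ n * (n : ℝ) ^ (-(c + 1)) := mul_le_mul hCn (hbound n hn₀n) (abs_nonneg _) hpos.le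
    _ = (n : ℝ) ^ (-c) := by
        rw [← Real.rpow_one_add' hpos.le (by linarith)]
        ring_nf

theorem aggregatorOblivious (D : System) (gen : ℕ → PMF PaillierKey) {lam : ℕ → ℕ}
    (hlam : Negligible fun κ => ((2 : ℝ) ^ lam κ)⁻¹) : AggregatorOblivious D gen lam := by
  intro A
  refine hlam.of_abs_le_const_mul (3 * D.M * D.na / 2) fun κ => ?_
  have hadvantage : 0 ≤ advantage (gen κ) (A κ) := abs_nonneg _
  rw [abs_of_nonneg hadvantage, abs_of_pos (by positivity)]
  exact advantage_le (gen κ) (A κ)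

end Advantage

end PackedWSA

theorem theorem2_general (D : System) (gen : ℕ → PMF PaillierKey) (lam : ℕ → ℕ)
    (hlam : Negligible fun κ => ((2 : ℝ) ^ lam κ)⁻¹) :
    IsCorrect D gen lam ∧ AggregatorOblivious D gen lam :=
  ⟨isCorrect D gen lam, aggregatorOblivious D gen hlam⟩

theorem theorem2 (D : System) (gen : ℕ → PMF PaillierKey) (hgen : IsKeyGenerator gen)
    (lam : ℕ → ℕ) (hlam : Negligible fun κ => ((2 : ℝ) ^ lam κ)⁻¹) :
    IsCorrect D gen lam ∧ AggregatorOblivious D gen lam :=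
  theorem2_general D gen lam hlam
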